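/- Let $D$ be a link diagram on the sphere $S^2$ with $n$ crossings. Suppose that $D$ is $k$-almost alternating, that is, $k$ is the least size of a set of crossings such that switching all crossings of the set turns $D$ into an alternating diagram; a set of crossings of this least size $k$ with this property is called a set of dealternators. Suppose also that $D$ is dealternator connected, that is, for some set of dealternators, each of the $2^k$ diagrams obtained by smoothing all $k$ dealternators, in every possible way, is connected. Let $\langle D\rangle\in\mathbb Z[A,A^{-1}]$ be the Kauffman bracket of $D$, $$\langle D\rangle=\sum_s A^{a(s)-b(s)}(-A^2-A^{-2})^{|sD|-1},$$ where $s$ runs over all choices of an $A$- or a $B$-smoothing at each crossing, $a(s)$ and $b(s)$ are the numbers of $A$- and $B$-smoothings in $s$, and $|sD|$ is the number of circles obtained by smoothing $D$ according to $s$. Let $\mathrm{span}$ denote the difference between the maximal and the minimal degree of a Laurent polynomial. Then $$\mathrm{span}(\langle D\rangle)\le 4(n-k).$$ Moreover, for every orientation of $D$, with writhe $w$, the Jones polynomial $V_L(t)=\big((-A^3)^{-w}\langle D\rangle\big)\big|_{A=t^{-1/4}}$ of the oriented link $L$ represented by $D$ satisfies $\mathrm{span}(\langle D\rangle)=4\,\mathrm{span}(V_L(t))$,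 and hence $$\mathrm{span}(V_L(t))\le n-k.$$ -/

import Mathlib

/-- The ends of edges at the crossings: `(c, i)` is the `i`-th of the four strand ends at the
crossing `c`, the ends being numbered counterclockwise. -/
abbrev Dart (X : Type*) := X × ZMod 4

/-- A link diagram on the oriented sphere `S²`, up to isotopy, whose set of crossings is the
finite set `X`. It consists of a 4-valent plane graph, presented by its rotation system
(the counterclockwise order of the four darts at each crossing, and the involution that matches
the two darts of each edge), of over/under information at every crossing, and of a number of
components without crossings. (For a disconnected diagram the relative position of the pieces
on the sphere is not recorded; nothing below depends on it.) -/
structure LinkDiagram (X : Type*) where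
  /-- the other end of the edge that starts at a given dart -/
  edge : Dart X → Dart X
  edge_edge : ∀ d, edge (edge d) = d
  edge_ne : ∀ d, edge d ≠ d
  /-- `overOdd c = true` if the darts `(c, 1)`, `(c, 3)` form the overcrossing strand at `c`, and
  `overOdd c = false` if the darts `(c, 0)`, `(c, 2)` do. -/
  overOdd : X → Bool
  /-- the number of components without crossings -/
  circles : ℕ
  /-- The graph lies on the sphere: Euler's formula `#V - #E + #F = 2 * #components`, where
  `#E = 2 * #V`. The faces are the orbits of the permutation that takes a
  dart `d` to the dart counterclockwise next to `edge d`, and the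
  components are those of the graph with vertex set `X`. -/
  planar :
    Nat.card (Quot fun d e : Dart X => e = ((edge d).1, (edge d).2 + 1)) =
      Nat.card X + 2 * Nat.card (Quot fun c c' : X => ∃ d : Dart X, d.1 = c ∧ (edge d).1 = c')

namespace LinkDiagram

variable {X : Type*}

/-- The dart `d` belongs to the overcrossing strand at its crossing. -/
def IsOver (D : LinkDiagram X) (d : Dart X) : Prop :=
  decide (d.2 = 1 ∨ d.2 = 3) = D.overOdd d.1

/-- Smooth the crossings in `S`: the crossing `c ∈ S` gets an `A`-smoothing if `s c = true` and a
`B`-smoothing if `s c = false`. The relation says that two darts are directly joined in the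
resulting diagram. The `A`-smoothing of a crossing opens the two regions that are swept out when
the overcrossing strand is rotated counterclockwise, so it joins each overcrossing dart to the
next dart in clockwise order; the `B`-smoothing joins it to the next one in counterclockwise
order. At a crossing that is not smoothed all four darts meet. -/
inductive Joined (D : LinkDiagram X) (S : Finset X) (s : X → Bool) : Dart X → Dart X → Prop
  | edge (d : Dart X) : Joined D S s d (D.edge d)
  | crossing (c : X) (i j : ZMod 4) : c ∉ S → Joined D S s (c, i) (c, j)
  | smoothA (c : X) (i : ZMod 4) : c ∈ S → s c = true → D.IsOver (c, i) →
      Joined D S s (c, i) (c, i - 1)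
  | smoothB (c : X) (i : ZMod 4) : c ∈ S → s c = false → D.IsOver (c, i) →
      Joined D S s (c, i) (c, i + 1)

/-- The number of connected components (as a subset of `S²`) of the projection of the diagram
obtained from `D` by smoothing the crossings in `S` according to `s`. -/
noncomputable def numPieces (D : LinkDiagram X) (S : Finset X) (s : X → Bool) : ℕ :=
  Nat.card (Quot (D.Joined S s)) + D.circles

/-- A diagram is alternating if along every component over- and undercrossings alternate, that
is, if every edge goes from an overcrossing to an undercrossing. -/
def IsAlternating (D : LinkDiagram X) : Prop :=
  ∀ d, D.IsOver (D.edge d) ↔ ¬ D.IsOver d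

variable [DecidableEq X]

/-- The diagram obtained from `D` by switching all the crossings in `S`. -/
def switch (D : LinkDiagram X) (S : Finset X) : LinkDiagram X where
  edge := D.edge
  edge_edge := D.edge_edge
  edge_ne := D.edge_ne
  overOdd c := xor (D.overOdd c) (decide (c ∈ S))
  circles := D.circles
  planar := D.planar

/-- `S` is a set of dealternators of `D`: a set of crossings of the least possible size such that
switching all of them makes `D` alternating. -/
def IsDealternatorSet (D : LinkDiagram X) (S : Finset X) : Prop :=
  (D.switch S).IsAlternating ∧ ∀ T : Finset X, (D.switch T).IsAlternating → S.card ≤ T.card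

/-- `D` is `k`-almost alternating: `k`, and not fewer, crossings have to be switched to make it
alternating. -/
def IsAlmostAlternating (D : LinkDiagram X) (k : ℕ) : Prop :=
  ∃ S, D.IsDealternatorSet S ∧ S.card = k

/-- `D` is dealternator connected (for some choice of its set of dealternators): every diagram
obtained by smoothing all the dealternators, in any possible way, is connected. -/
def IsDealternatorConnected (D : LinkDiagram X) : Prop :=
  ∃ S, D.IsDealternatorSet S ∧ ∀ s : X → Bool, D.numPieces S s = 1

variable [Fintype X]

/-- The number `|sD|` of circles that appear when all the crossings are smoothed according to
the state `s`. -/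
noncomputable def stateCircles (D : LinkDiagram X) (s : X → Bool) : ℕ :=
  D.numPieces Finset.univ s

open LaurentPolynomial in
/-- The Kauffman bracket `⟨D⟩ ∈ ℤ[A, A⁻¹]`, normalised to be `1` on the circle without crossings:
`⟨D⟩ = ∑ₛ A ^ (a(s) - b(s)) (-A² - A⁻²) ^ (|sD| - 1)`, where `s` assigns `a(s)` `A`-smoothings and
`b(s)` `B`-smoothings. (`|sD| ≥ 1` unless the diagram is empty.) -/
noncomputable def bracket (D : LinkDiagram X) : LaurentPolynomial ℤ :=
  ∑ s : X → Bool,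
    T (∑ c, if s c = true then 1 else -1) * (-T 2 - T (-2)) ^ (D.stateCircles s - 1)

/-- An orientation of (the components with crossings of) `D`: `out d` says that the strand leaves
the crossing at the dart `d`. -/
structure Orientation (D : LinkDiagram X) where
  out : Dart X → Prop
  out_edge : ∀ d, out (D.edge d) ↔ ¬ out d
  out_opposite : ∀ d : Dart X, out (d.1, d.2 + 2) ↔ ¬ out d

open Classical in
/-- The writhe of an oriented diagram: the sum of the signs of its crossings. A crossing is
positive if the outgoing end of the understrand comes next, in counterclockwise order, after the
outgoing end of the overstrand. -/
noncomputable def writhe (D : LinkDiagram X) (o : D.Orientation) : ℤ :=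
  ∑ c : X, if ∃ i : ZMod 4, D.IsOver (c, i) ∧ o.out (c, i) ∧ o.out (c, i + 1) then 1 else -1

open LaurentPolynomial in
/-- The Jones polynomial of the oriented link represented by `D` with the orientation `o`:
`V(t) = (-A³) ^ (-w) ⟨D⟩` with `A = t ^ (-1/4)`, where `w` is the writhe. It is written in the ring
of integral combinations of rational powers of `t`. -/
noncomputable def jones (D : LinkDiagram X) (o : D.Orientation) : AddMonoidAlgebra ℤ ℚ :=
  AddMonoidAlgebra.mapDomain (fun e : ℤ => -(e : ℚ) / 4)
    (C ((Int.negOnePow (D.writhe o) : ℤˣ) : ℤ) * T (-3 * D.writhe o) * D.bracket)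

/-- The Kauffman bracket does not vanish, so that its extreme degrees make sense. -/
theorem bracket_ne_zero (D : LinkDiagram X) : D.bracket ≠ 0 := by
  intro h
  have h1 := congrArg (LaurentPolynomial.eval₂ (Int.castRingHom (ZMod 3)) 1) h
  rw [bracket, map_sum, map_zero] at h1
  have h2 : (-1 - 1 : ZMod 3) = 1 := by decide
  have h3 : (2 : ZMod 3) = -1 := by decide
  simp [LaurentPolynomial.eval₂_T, h2, h3] at h1

end LinkDiagram

/-- The span of a (Laurent) polynomial: its maximal degree minus its minimal degree (and `0` for
the zero polynomial). -/
noncomputable def polySpan {G : Type*} [AddCommGroup G] [LinearOrder G]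
    (f : AddMonoidAlgebra ℤ G) : G :=
  if h : f.coeff.support.Nonempty then f.coeff.support.max' h - f.coeff.support.min' h else 0

/-! Write `n` for the number of crossings and `a`, `b` for the circle counts of the all-`A` and
all-`B` states. Everything rests on a dual state lemma, `stateCircles_add_stateCircles_le`: if two
states agree exactly on `S`, then their circle counts and `#S` sum to at most `n` plus twice the
number of pieces left by smoothing `S` alone. Over `ZMod 2`, functions constant on the circles of a
state map to functions on the crossings outside `S`; the kernel counts the pieces, and the images
for the two states are orthogonal.

The lemma puts all exponents of the bracket between `-n - 2(b - 1)` and `n + 2(a - 1)`. It also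
compares the all-`A` and all-`B` states with the two extreme states of the alternating diagram
obtained by switching the dealternators, which by Euler's formula have at least `n + 2` circles
together. Hence `a + b + 2k ≤ n + 2`, and the span is at most `2n + 2(a + b - 2) ≤ 4(n - k)`. -/

open Module in
/-- Orthogonal subspaces of `K ^ ι`, for the standard dot product, have complementary dimensions
at most. -/
theorem finrank_add_finrank_le_of_dotProduct_eq_zero {K ι : Type*} [Field K] [Fintype ι]
    [DecidableEq ι] (P Q : Submodule K (ι → K)) (h : ∀ p ∈ P, ∀ q ∈ Q, q ⬝ᵥ p = 0) :
    finrank K P + finrank K Q ≤ Fintype.card ι := by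
  have h1 : Q.map (dotProductEquiv K ι).toLinearMap ≤ P.dualAnnihilator := by
    rintro _ ⟨q, hq, rfl⟩
    rw [Submodule.mem_dualAnnihilator]
    intro p hp
    exact h p hp q hq
  have h2 := Submodule.finrank_mono h1
  rw [LinearEquiv.finrank_map_eq] at h2
  have h3 := Subspace.finrank_add_finrank_dualAnnihilator_eq P
  rw [finrank_fintype_fun_eq_card] at h3
  omega

/-- The functions on `α` that are constant along the relation `r`. -/
def invariantFun (K : Type*) [Field K] {α : Type*} (r : α → α → Prop) : Submodule K (α → K) where
  carrier := {x | ∀ a b, r a b → x a = x b}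
  add_mem' hx hy a b h := by simp [hx a b h, hy a b h]
  zero_mem' _ _ _ := rfl
  smul_mem' t x hx a b h := by simp [hx a b h]

theorem mem_invariantFun {K : Type*} [Field K] {α : Type*} {r : α → α → Prop} {x : α → K} :
    x ∈ invariantFun K r ↔ ∀ a b, r a b → x a = x b := Iff.rfl

/-- Functions constant along `r` are functions on the quotient by `r`. -/
def invariantFunEquiv (K : Type*) [Field K] {α : Type*} (r : α → α → Prop) :
    (Quot r → K) ≃ₗ[K] invariantFun K r where
  toFun g := ⟨fun a => g (Quot.mk r a), fun _ _ h => congrArg g (Quot.sound h)⟩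
  invFun x := Quot.lift x.1 x.2
  map_add' _ _ := rfl
  map_smul' _ _ := rfl
  left_inv g := by ext q; induction q using Quot.ind; rfl
  right_inv _ := rfl

theorem finrank_invariantFun (K : Type*) [Field K] {α : Type*} [Finite α] (r : α → α → Prop) :
    Module.finrank K (invariantFun K r) = Nat.card (Quot r) := by
  have := Fintype.ofFinite (Quot r)
  rw [← (invariantFunEquiv K r).finrank_eq, Module.finrank_fintype_fun_eq_card,
    Nat.card_eq_fintype_card]

open Module in
theorem finrank_map_add_finrank_inf_ker {K V W : Type*} [Field K] [AddCommGroup V] [Module K V]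
    [FiniteDimensional K V] [AddCommGroup W] [Module K W] (f : V →ₗ[K] W) (A : Submodule K V) :
    finrank K (A.map f) + finrank K (A ⊓ LinearMap.ker f : Submodule K V) = finrank K A := by
  rw [← LinearMap.finrank_range_add_finrank_ker (f.domRestrict A), LinearMap.range_domRestrict,
    ← Submodule.finrank_map_subtype_eq A (LinearMap.ker (f.domRestrict A)),
    LinearMap.ker_domRestrict, Submodule.map_comap_subtype]

/-! ### Circles of states and the dual state lemma -/

namespace LinkDiagram

variable {X : Type*}

theorem isOver_iff (D : LinkDiagram X) (c : X) :
    (D.IsOver (c, 0) ↔ D.overOdd c = false) ∧ (D.IsOver (c, 1) ↔ D.overOdd c = true) ∧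
      (D.IsOver (c, 2) ↔ D.overOdd c = false) ∧ (D.IsOver (c, 3) ↔ D.overOdd c = true) := by
  have h : (decide ((0 : ZMod 4) = 1 ∨ (0 : ZMod 4) = 3) = false) ∧
    (decide ((2 : ZMod 4) = 1 ∨ (2 : ZMod 4) = 3) = false) := by decide
  refine ⟨?_, ?_, ?_, ?_⟩ <;> simp only [IsOver, h.1, h.2] <;>
    simp only [true_or, or_true, decide_true, eq_comm]

theorem forall_zmod_four {p : ZMod 4 → Prop} : (∀ i, p i) ↔ p 0 ∧ p 1 ∧ p 2 ∧ p 3 :=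
  ⟨fun h => ⟨h 0, h 1, h 2, h 3⟩, fun ⟨h0, h1, h2, h3⟩ i => by
    fin_cases i
    exacts [h0, h1, h2, h3]⟩

/-- Which functions on the darts are constant along the pieces of a partial smoothing. -/
theorem mem_invariantFun_joined {K : Type*} [Field K] (D : LinkDiagram X) (S : Finset X)
    (s : X → Bool) (x : Dart X → K) :
    x ∈ invariantFun K (D.Joined S s) ↔ (∀ d, x (D.edge d) = x d) ∧
      (∀ c ∉ S, x (c, 0) = x (c, 1) ∧ x (c, 1) = x (c, 2) ∧ x (c, 2) = x (c, 3)) ∧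
      (∀ c ∈ S, s c = D.overOdd c → x (c, 0) = x (c, 1) ∧ x (c, 2) = x (c, 3)) ∧
      (∀ c ∈ S, s c ≠ D.overOdd c → x (c, 1) = x (c, 2) ∧ x (c, 3) = x (c, 0)) := by
  have e : (0 - 1 : ZMod 4) = 3 ∧ (1 - 1 : ZMod 4) = 0 ∧ (2 - 1 : ZMod 4) = 1 ∧
      (3 - 1 : ZMod 4) = 2 ∧ (0 + 1 : ZMod 4) = 1 ∧ (1 + 1 : ZMod 4) = 2 ∧
      (2 + 1 : ZMod 4) = 3 ∧ (3 + 1 : ZMod 4) = 0 := by decide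
  obtain ⟨e0, e1, e2, e3, f0, f1, f2, f3⟩ := e
  rw [mem_invariantFun]
  constructor
  · intro h
    refine ⟨fun d => (h _ _ (.edge d)).symm, fun c hc => ⟨h _ _ (.crossing c _ _ hc),
      h _ _ (.crossing c _ _ hc), h _ _ (.crossing c _ _ hc)⟩, fun c hc hs => ?_,
      fun c hc hs => ?_⟩
    all_goals
      have hA := fun i => fun h1 h2 => h _ _ (.smoothA c i hc h1 h2)
      have hB := fun i => fun h1 h2 => h _ _ (.smoothB c i hc h1 h2)
      rw [forall_zmod_four] at hA hB
      obtain ⟨i0, i1, i2, i3⟩ := D.isOver_iff c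
      simp only [i0, i1, i2, i3, e0, e1, e2, e3, f0, f1, f2, f3] at hA hB
      cases h1 : s c <;> cases h2 : D.overOdd c <;> grind
  · rintro ⟨he, hn, h1, h2⟩ a b hab
    cases hab with
    | edge => exact (he a).symm
    | crossing c i j hc =>
      obtain ⟨k0, k1, k2⟩ := hn c hc
      have : ∀ i, x (c, i) = x (c, 0) := by
        rw [forall_zmod_four]
        exact ⟨rfl, k0.symm, (k0.trans k1).symm, (k0.trans (k1.trans k2)).symm⟩
      rw [this i, this j]
    | smoothA c i hc hs ho =>
      revert i
      rw [forall_zmod_four]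
      obtain ⟨i0, i1, i2, i3⟩ := D.isOver_iff c
      have h1 := h1 c hc
      have h2 := h2 c hc
      simp only [i0, i1, i2, i3, e0, e1, e2, e3]
      cases h3 : D.overOdd c <;> grind
    | smoothB c i hc hs ho =>
      revert i
      rw [forall_zmod_four]
      obtain ⟨i0, i1, i2, i3⟩ := D.isOver_iff c
      have h1 := h1 c hc
      have h2 := h2 c hc
      simp only [i0, i1, i2, i3, f0, f1, f2, f3]
      cases h3 : D.overOdd c <;> grind

/-- The map that measures, at each crossing outside `S`, how a function on the darts differs
between two opposite darts. -/
def oppositeDiff (S : Finset X) : (Dart X → ZMod 2) →ₗ[ZMod 2] ({c // c ∉ S} → ZMod 2) where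
  toFun x c := x (c.1, 0) + x (c.1, 2)
  map_add' x y := by ext c; simp only [Pi.add_apply]; ring
  map_smul' t x := by ext c; simp only [Pi.smul_apply, smul_eq_mul, RingHom.id_apply]; ring

theorem oppositeDiff_apply (S : Finset X) (x : Dart X → ZMod 2) (c : {c // c ∉ S}) :
    oppositeDiff S x c = x (c.1, 0) + x (c.1, 2) := rfl

variable [Fintype X]

/-- Either smoothing puts the ends 0 and 2 on different arcs, so equal values there make all four
ends agree, as at an unsmoothed crossing. -/
theorem invariantFun_inf_ker_oppositeDiff (D : LinkDiagram X) (S : Finset X)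
    (s t : X → Bool) (hst : ∀ c ∈ S, s c = t c) :
    invariantFun (ZMod 2) (D.Joined Finset.univ t) ⊓ LinearMap.ker (oppositeDiff S) =
      invariantFun (ZMod 2) (D.Joined S s) := by
  have key : ∀ a b : ZMod 2, a + b = 0 ↔ a = b := by decide
  ext x
  rw [Submodule.mem_inf, mem_invariantFun_joined, mem_invariantFun_joined, LinearMap.mem_ker,
    funext_iff]
  simp only [oppositeDiff_apply, Pi.zero_apply, key, Subtype.forall, Finset.mem_univ]
  constructor
  · rintro ⟨⟨h1, -, h2, h3⟩, h4⟩
    refine ⟨h1, fun c hc => ?_, fun c hc h => h2 c trivial (hst c hc ▸ h),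
      fun c hc h => h3 c trivial (hst c hc ▸ h)⟩
    have h4 := h4 c hc
    by_cases h : t c = D.overOdd c
    · obtain ⟨h5, h6⟩ := h2 c trivial h
      exact ⟨h5, by rw [← h5, h4], h6⟩
    · obtain ⟨h5, h6⟩ := h3 c trivial h
      exact ⟨by rw [h4, h5], h5, by rw [h6, h4]⟩
  · rintro ⟨h1, h2, h3, h4⟩
    refine ⟨⟨h1, by simp, fun c _ h => ?_, fun c _ h => ?_⟩, fun c hc => ?_⟩
    · by_cases hc : c ∈ S
      · exact h3 c hc ((hst c hc).trans h)
      · exact ⟨(h2 c hc).1, (h2 c hc).2.2⟩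
    · by_cases hc : c ∈ S
      · exact h4 c hc (fun h' => h ((hst c hc).symm.trans h'))
      · obtain ⟨h5, h6, h7⟩ := h2 c hc
        exact ⟨h6, by rw [← h7, ← h6, h5]⟩
    · obtain ⟨h5, h6, h7⟩ := h2 c hc
      rw [h5, h6]

theorem sum_dart {M : Type*} [AddCommMonoid M] (f : Dart X → M) :
    ∑ d, f d = ∑ c, (f (c, 0) + f (c, 1) + f (c, 2) + f (c, 3)) := by
  rw [Fintype.sum_prod_type]
  exact Finset.sum_congr rfl fun c _ => Fin.sum_univ_four fun i : Fin 4 => f (c, i)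

variable [DecidableEq X]

/-- The function spaces of two states that agree on `S` and are opposite outside `S` have
orthogonal images. -/
theorem dotProduct_oppositeDiff (D : LinkDiagram X) (S : Finset X) (s t : X → Bool)
    (hst : ∀ c, s c = t c ↔ c ∈ S) (x y : Dart X → ZMod 2)
    (hx : x ∈ invariantFun (ZMod 2) (D.Joined Finset.univ s))
    (hy : y ∈ invariantFun (ZMod 2) (D.Joined Finset.univ t)) :
    oppositeDiff S y ⬝ᵥ oppositeDiff S x = 0 := by
  rw [mem_invariantFun_joined] at hx hy
  obtain ⟨x1, -, x2, x3⟩ := hx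
  obtain ⟨y1, -, y2, y3⟩ := hy
  have two : ∀ a : ZMod 2, a + a = 0 := by decide
  have key1 : ∀ a b c d : ZMod 2, (c + d) * (a + b) = a * c + a * d + b * d + b * c := by decide
  have key2 : ∀ a b c d : ZMod 2, (c + d) * (a + b) = a * c + b * c + b * d + a * d := by decide
  have key3 : ∀ a b c d : ZMod 2, 0 = a * c + a * c + b * d + b * d := by decide
  have key4 : ∀ a b c d : ZMod 2, 0 = a * c + b * d + b * d + a * c := by decide
  -- The two ends of an edge contribute equal products, which cancel in characteristic 2.
  have h0 : ∑ d, x d * y d = 0 := by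
    refine Finset.sum_involution (fun d _ => D.edge d) (fun d _ => ?_) (fun d _ _ => D.edge_ne d)
      (fun _ _ => Finset.mem_univ _) (fun d _ => D.edge_edge d)
    rw [x1, y1, two]
  rw [sum_dart] at h0
  have h1 : oppositeDiff S y ⬝ᵥ oppositeDiff S x =
      ∑ c ∈ Finset.univ.filter (· ∉ S), (y (c, 0) + y (c, 2)) * (x (c, 0) + x (c, 2)) := by
    rw [dotProduct, Finset.sum_subtype (p := (· ∉ S)) _ (by simp)]
    rfl
  rw [h1, ← h0, Finset.sum_filter]
  refine Finset.sum_congr rfl fun c _ => ?_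
  have hc := hst c
  have x2 := x2 c (Finset.mem_univ c)
  have x3 := x3 c (Finset.mem_univ c)
  have y2 := y2 c (Finset.mem_univ c)
  have y3 := y3 c (Finset.mem_univ c)
  -- Equal smoothings pair equal products, which cancel. Opposite smoothings produce each product of
  -- an arc value of `x` with an arc value of `y` once, and the sum factors.
  by_cases h : s c = D.overOdd c <;> by_cases h' : t c = D.overOdd c
  · rw [if_neg (by rw [not_not, ← hc, h, h'])]
    rw [← (x2 h).1, ← (x2 h).2, ← (y2 h').1, ← (y2 h').2]
    exact key3 _ _ _ _
  · rw [if_pos (by rw [← hc, h]; exact fun e => h' e.symm)]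
    rw [← (x2 h).1, ← (x2 h).2, (y3 h').1, (y3 h').2]
    exact key1 _ _ _ _
  · rw [if_pos (by rw [← hc, h']; exact h)]
    rw [← (y2 h').1, ← (y2 h').2, (x3 h).1, (x3 h).2]
    exact key2 _ _ _ _
  · rw [if_neg (by
      rw [not_not, ← hc]; revert h h'; cases s c <;> cases t c <;> cases D.overOdd c <;> simp)]
    rw [(x3 h).1, (x3 h).2, (y3 h').1, (y3 h').2]
    exact key4 _ _ _ _

/-- The dual state lemma for a partially smoothed diagram. -/
theorem stateCircles_add_stateCircles_le (D : LinkDiagram X) (S : Finset X) (s t : X → Bool)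
    (hst : ∀ c, s c = t c ↔ c ∈ S) :
    D.stateCircles s + D.stateCircles t + S.card ≤ Fintype.card X + 2 * D.numPieces S s := by
  have h := finrank_add_finrank_le_of_dotProduct_eq_zero
    ((invariantFun (ZMod 2) (D.Joined Finset.univ s)).map (oppositeDiff S))
    ((invariantFun (ZMod 2) (D.Joined Finset.univ t)).map (oppositeDiff S)) (by
      rintro _ ⟨x, hx, rfl⟩ _ ⟨y, hy, rfl⟩
      exact D.dotProduct_oppositeDiff S s t hst x y hx hy)
  have h1 := finrank_map_add_finrank_inf_ker (oppositeDiff S)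
    (invariantFun (ZMod 2) (D.Joined Finset.univ s))
  have h2 := finrank_map_add_finrank_inf_ker (oppositeDiff S)
    (invariantFun (ZMod 2) (D.Joined Finset.univ t))
  rw [D.invariantFun_inf_ker_oppositeDiff S s s fun _ _ => rfl] at h1
  rw [D.invariantFun_inf_ker_oppositeDiff S s t fun c hc => (hst c).2 hc] at h2
  rw [finrank_invariantFun, finrank_invariantFun] at h1 h2
  have h3 : Fintype.card {c // c ∉ S} + S.card = Fintype.card X := by
    rw [Fintype.card_subtype_compl, Fintype.card_coe]
    exact Nat.sub_add_cancel S.card_le_univ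
  simp only [stateCircles, numPieces]
  omega

omit [DecidableEq X] in
theorem numPieces_le_stateCircles (D : LinkDiagram X) (S : Finset X) (s t : X → Bool)
    (hst : ∀ c ∈ S, s c = t c) : D.numPieces S s ≤ D.stateCircles t := by
  have h := finrank_map_add_finrank_inf_ker (oppositeDiff S)
    (invariantFun (ZMod 2) (D.Joined Finset.univ t))
  rw [D.invariantFun_inf_ker_oppositeDiff S s t hst, finrank_invariantFun,
    finrank_invariantFun] at h
  simp only [stateCircles, numPieces]
  omega

theorem stateCircles_switch (D : LinkDiagram X) (S : Finset X) (s : X → Bool) :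
    (D.switch S).stateCircles s = D.stateCircles fun c => xor (s c) (decide (c ∈ S)) := by
  have h : invariantFun (ZMod 2) ((D.switch S).Joined Finset.univ s) =
      invariantFun (ZMod 2)
        (D.Joined Finset.univ fun c => xor (s c) (decide (c ∈ S))) := by
    ext x
    rw [mem_invariantFun_joined, mem_invariantFun_joined]
    have h1 : ∀ c, (s c = (D.switch S).overOdd c ↔
        xor (s c) (decide (c ∈ S)) = D.overOdd c) := by
      intro c
      simp only [switch]
      cases s c <;> cases D.overOdd c <;> cases decide (c ∈ S) <;> simp
    simp only [ne_eq, h1]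
    rfl
  simp only [stateCircles, numPieces]
  rw [← finrank_invariantFun (ZMod 2), h, finrank_invariantFun]
  rfl

/-! ### Extreme states of alternating and almost alternating diagrams -/

omit [DecidableEq X] in
/-- Euler's formula for an alternating diagram, in terms of its two extreme states. -/
theorem IsAlternating.card_add_two_le {D : LinkDiagram X} (hD : D.IsAlternating)
    (h : Nonempty X ∨ 0 < D.circles) :
    Fintype.card X + 2 ≤ D.stateCircles (fun _ => true) + D.stateCircles (fun _ => false) := by
  classical
  let face := fun d e : Dart X => e = ((D.edge d).1, (D.edge d).2 + 1)
  have hsucc : ∀ d : Dart X, D.IsOver (d.1, d.2 + 1) ↔ ¬ D.IsOver d := by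
    rintro ⟨c, i⟩
    revert i
    obtain ⟨i0, i1, i2, i3⟩ := D.isOver_iff c
    have e : (0 + 1 : ZMod 4) = 1 ∧ (1 + 1 : ZMod 4) = 2 ∧
      (2 + 1 : ZMod 4) = 3 ∧ (3 + 1 : ZMod 4) = 0 := by decide
    simp only [forall_zmod_four, e.1, e.2.1, e.2.2.1, e.2.2.2, i0, i1, i2, i3]
    simp
  have hpred : ∀ d : Dart X, D.IsOver (d.1, d.2 - 1) ↔ ¬ D.IsOver d := by
    intro d
    have := hsucc (d.1, d.2 - 1)
    simp only [sub_add_cancel] at this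
    tauto
  have hface : ∀ d : Dart X, Quot.mk face (D.edge d) = Quot.mk face (d.1, d.2 + 1) := by
    intro d
    refine Quot.sound ?_
    simp only [face, D.edge_edge]
  -- In an alternating diagram each extreme-state circle follows a single face, named by the over
  -- ends of its edges for `A` and by the under ends for `B`. Every dart is one or the other, so all
  -- faces are hit.
  let fA : Quot (D.Joined Finset.univ fun _ => true) → Quot face :=
    Quot.lift (fun d => if D.IsOver d then Quot.mk face d else Quot.mk face (D.edge d)) (by
      intro a b hab
      cases hab with
      | edge => by_cases h : D.IsOver a <;> simp [h, hD a, D.edge_edge]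
      | crossing c i j hc => simp at hc
      | smoothA c i hc hs ho =>
        have h1 := hpred (c, i)
        simp only at h1
        rw [if_pos ho, if_neg (by rw [h1]; simpa using ho), hface]
        simp
      | smoothB c i hc hs ho => simp at hs)
  let fB : Quot (D.Joined Finset.univ fun _ => false) → Quot face :=
    Quot.lift (fun d => if D.IsOver d then Quot.mk face (D.edge d) else Quot.mk face d) (by
      intro a b hab
      cases hab with
      | edge => by_cases h : D.IsOver a <;> simp [h, hD a, D.edge_edge]
      | crossing c i j hc => simp at hc
      | smoothB c i hc hs ho =>
        have h1 := hsucc (c, i)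
        simp only at h1
        rw [if_pos ho, if_neg (by rw [h1]; simpa using ho), hface]
      | smoothA c i hc hs ho => simp at hs)
  have hsurj : Function.Surjective (Sum.elim fA fB) := by
    intro q
    induction q using Quot.ind with
    | mk d =>
      by_cases h : D.IsOver d
      · exact ⟨Sum.inl (Quot.mk _ d), if_pos h⟩
      · exact ⟨Sum.inr (Quot.mk _ d), if_neg h⟩
  have h1 := Nat.card_le_card_of_surjective _ hsurj
  rw [Nat.card_sum] at h1
  have h2 : Nat.card (Quot face) = _ := D.planar
  rw [Nat.card_eq_fintype_card (α := X)] at h2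
  simp only [stateCircles, numPieces]
  -- The summand 2 comes from a component with crossings, or else from a crossingless circle,
  -- counted in both states.
  rcases h with ⟨⟨c⟩⟩ | h
  · have : 0 < Nat.card (Quot fun c c' : X => ∃ d : Dart X, d.1 = c ∧ (D.edge d).1 = c') :=
      Nat.card_pos_iff.2 ⟨⟨Quot.mk _ c⟩, inferInstance⟩
    omega
  · omega

/-- The two extreme states of a dealternator connected diagram have few circles. -/
theorem stateCircles_true_add_stateCircles_false_le (D : LinkDiagram X) (S : Finset X)
    (hS : (D.switch S).IsAlternating) (h1 : D.numPieces S (fun _ => true) = 1)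
    (h2 : D.numPieces S (fun _ => false) = 1) :
    D.stateCircles (fun _ => true) + D.stateCircles (fun _ => false) + 2 * S.card ≤
      Fintype.card X + 2 := by
  have hne : Nonempty X ∨ 0 < (D.switch S).circles := by
    by_contra! h
    obtain ⟨hX, h⟩ := h
    have : D.circles = 0 := Nat.le_zero.1 h
    simp [numPieces, this] at h1
  have h3 := hS.card_add_two_le hne
  rw [stateCircles_switch, stateCircles_switch] at h3
  -- The partners, opposite to the constant states outside `S`, are the all-`B` and all-`A` states
  -- of the switched diagram, bounded below by `h3`.
  have h4 := D.stateCircles_add_stateCircles_le S (fun _ => true)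
    (fun c => xor false (decide (c ∈ S))) (by simp)
  have h5 := D.stateCircles_add_stateCircles_le S (fun _ => false)
    (fun c => xor true (decide (c ∈ S))) (by simp)
  omega

end LinkDiagram

/-! ### Supports and spans of Laurent polynomials -/

section Support

open LaurentPolynomial

theorem LaurentPolynomial.support_mul_subset_Icc {f g : LaurentPolynomial ℤ} {a b c d : ℤ}
    (hf : f.coeff.support ⊆ Finset.Icc a b) (hg : g.coeff.support ⊆ Finset.Icc c d) :
    (f * g).coeff.support ⊆ Finset.Icc (a + c) (b + d) := by
  intro e he
  obtain ⟨x, hx, y, hy, rfl⟩ := Finset.mem_add.1 (AddMonoidAlgebra.support_coeff_mul_subset f g he)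
  have h1 := Finset.mem_Icc.1 (hf hx)
  have h2 := Finset.mem_Icc.1 (hg hy)
  exact Finset.mem_Icc.2 ⟨by omega, by omega⟩

theorem LaurentPolynomial.support_T_subset_Icc (n : ℤ) :
    (T n : LaurentPolynomial ℤ).coeff.support ⊆ Finset.Icc n n := by
  intro e he
  rw [Finsupp.mem_support_iff, T_apply] at he
  have : n = e := by by_contra h; simp [h] at he
  simp [this]

theorem LaurentPolynomial.support_loop_pow_subset_Icc (m : ℕ) :
    ((-T 2 - T (-2) : LaurentPolynomial ℤ) ^ m).coeff.support ⊆
      Finset.Icc (-2 * (m : ℤ)) (2 * m) := by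
  induction m with
  | zero => simpa using support_T_subset_Icc 0
  | succ m ih =>
    have h : (-T 2 - T (-2) : LaurentPolynomial ℤ).coeff.support ⊆ Finset.Icc (-2) 2 := by
      intro e he
      rw [Finsupp.mem_support_iff, AddMonoidAlgebra.coeff_sub, AddMonoidAlgebra.coeff_neg,
        Finsupp.sub_apply, Finsupp.neg_apply, T_apply, T_apply] at he
      rw [Finset.mem_Icc]
      by_contra h
      rw [if_neg (by omega), if_neg (by omega)] at he
      simp at he
    rw [pow_succ]
    convert support_mul_subset_Icc ih h using 2 <;> push_cast <;> ring

theorem polySpan_le_of_support_subset_Icc {f : AddMonoidAlgebra ℤ ℤ} (hf : f ≠ 0) {a b : ℤ}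
    (h : f.coeff.support ⊆ Finset.Icc a b) : polySpan f ≤ b - a := by
  have hne : f.coeff.support.Nonempty := by
    rwa [Finsupp.support_nonempty_iff, ne_eq, AddMonoidAlgebra.coeff_eq_zero]
  rw [polySpan, dif_pos hne]
  have h1 := Finset.mem_Icc.1 (h (Finset.max'_mem _ hne))
  have h2 := Finset.mem_Icc.1 (h (Finset.min'_mem _ hne))
  omega

/-- Reversing and rescaling the exponents rescales the span. -/
theorem polySpan_of_support_eq_image {f : AddMonoidAlgebra ℤ ℤ} {g : AddMonoidAlgebra ℤ ℚ} (m : ℤ)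
    (h : g.coeff.support = f.coeff.support.image fun e => -((m + e : ℤ) : ℚ) / 4) :
    ((polySpan f : ℤ) : ℚ) = 4 * polySpan g := by
  by_cases hf : f.coeff.support.Nonempty
  · have hg : g.coeff.support.Nonempty := h ▸ hf.image _
    have hmax : g.coeff.support.max' hg = -((m + f.coeff.support.min' hf : ℤ) : ℚ) / 4 := by
      refine (Finset.max'_eq_iff _ _ _).2 ⟨?_, fun b hb => ?_⟩
      · rw [h]
        exact Finset.mem_image_of_mem _ (Finset.min'_mem _ hf)
      · rw [h] at hb
        obtain ⟨e, he, rfl⟩ := Finset.mem_image.1 hb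
        have : ((f.coeff.support.min' hf : ℤ) : ℚ) ≤ e :=
          Int.cast_le.2 (Finset.min'_le _ _ he)
        push_cast
        linarith
    have hmin : g.coeff.support.min' hg = -((m + f.coeff.support.max' hf : ℤ) : ℚ) / 4 := by
      refine (Finset.min'_eq_iff _ _ _).2 ⟨?_, fun b hb => ?_⟩
      · rw [h]
        exact Finset.mem_image_of_mem _ (Finset.max'_mem _ hf)
      · rw [h] at hb
        obtain ⟨e, he, rfl⟩ := Finset.mem_image.1 hb
        have : (e : ℚ) ≤ (f.coeff.support.max' hf : ℤ) :=
          Int.cast_le.2 (Finset.le_max' _ _ he)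
        push_cast
        linarith
    rw [polySpan, polySpan, dif_pos hf, dif_pos hg, hmax, hmin]
    push_cast
    ring
  · have hg : ¬ g.coeff.support.Nonempty := by rwa [h, Finset.image_nonempty]
    rw [polySpan, polySpan, dif_neg hf, dif_neg hg]
    simp

end Support

/-! ### Exponents of the bracket and of the Jones polynomial -/

namespace LinkDiagram

variable {X : Type*} [Fintype X] [DecidableEq X]

/-- The exponents in the Kauffman bracket lie between those of the two extreme states. -/
theorem support_bracket_subset_Icc (D : LinkDiagram X) (hD : ∀ s, 1 ≤ D.stateCircles s) :
    D.bracket.coeff.support ⊆ Finset.Icc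
      (-(Fintype.card X : ℤ) - 2 * (D.stateCircles (fun _ => false) - 1))
      (Fintype.card X + 2 * (D.stateCircles (fun _ => true) - 1)) := by
  rw [bracket, AddMonoidAlgebra.coeff_sum]
  refine Finsupp.support_finsetSum.trans (Finset.biUnion_subset.2 fun s _ => ?_)
  refine (LaurentPolynomial.support_mul_subset_Icc (LaurentPolynomial.support_T_subset_Icc _)
    (LaurentPolynomial.support_loop_pow_subset_Icc _)).trans (Finset.Icc_subset_Icc ?_ ?_)
  all_goals
    have hsum : (∑ c, if s c = true then (1 : ℤ) else -1) =
        (Finset.univ.filter fun c => s c = true).card -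
          (Finset.univ.filter fun c => s c = false).card := by
      rw [Finset.sum_ite]
      simp [sub_eq_add_neg]
    have hcard : (Finset.univ.filter fun c => s c = true).card +
        (Finset.univ.filter fun c => s c = false).card = Fintype.card X := by
      simpa using Finset.card_filter_add_card_filter_not (s := Finset.univ) fun c => s c = true
    -- Positivity keeps the natural subtraction in the loop exponent from truncating.
    have hs := hD s
    rw [hsum]
  -- Together these say that `s` has at most as many circles as the all-`B` state plus its number of
  -- `A`-smoothings; the other bound is symmetric.
  · have h1 := D.stateCircles_add_stateCircles_le
      (Finset.univ.filter fun c => s c = false) s (fun _ => false) (by simp)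
    have h2 := D.numPieces_le_stateCircles
      (Finset.univ.filter fun c => s c = false) s (fun _ => false) (by simp)
    omega
  · have h1 := D.stateCircles_add_stateCircles_le
      (Finset.univ.filter fun c => s c = true) s (fun _ => true) (by simp)
    have h2 := D.numPieces_le_stateCircles
      (Finset.univ.filter fun c => s c = true) s (fun _ => true) (by simp)
    omega

/-- The writhe factor is a monomial with unit coefficient, and the change of variable is injective
on exponents, so nothing cancels. -/
theorem support_jones (D : LinkDiagram X) (o : D.Orientation) :
    (D.jones o).coeff.support =
      D.bracket.coeff.support.image fun e => -((-3 * D.writhe o + e : ℤ) : ℚ) / 4 := by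
  have hinj : Function.Injective fun e : ℤ => -(e : ℚ) / 4 := by
    intro a b h
    have : (a : ℚ) = b := by simp only at h; linarith
    exact_mod_cast this
  have hunit : ∀ y : ℤ,
      ((Int.negOnePow (D.writhe o) : ℤˣ) : ℤ) * y = 0 ↔ y = 0 := fun y => by simp
  rw [jones, AddMonoidAlgebra.coeff_mapDomain, Finsupp.mapDomain_support_of_injective hinj,
    ← LaurentPolynomial.single_eq_C_mul_T, AddMonoidAlgebra.support_coeff_single_mul_eq_image _
      hunit (IsAddLeftRegular.all _), Finset.image_image]
  rfl

end LinkDiagram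

theorem mainTheorem3 {X : Type*} [Fintype X] [DecidableEq X] (D : LinkDiagram X) (n k : ℕ)
    (hn : Fintype.card X = n) (hk : D.IsAlmostAlternating k) (hD : D.IsDealternatorConnected) :
    polySpan D.bracket ≤ 4 * ((n : ℤ) - (k : ℤ)) ∧
      ∀ o : D.Orientation,
        ((polySpan D.bracket : ℤ) : ℚ) = 4 * polySpan (D.jones o) ∧
          polySpan (D.jones o) ≤ (n : ℚ) - (k : ℚ) := by
  obtain ⟨S₀, hS₀, hcard⟩ := hk
  obtain ⟨S, hS, hconn⟩ := hD
  have hSk : S.card = k := by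
    rw [← hcard]
    exact le_antisymm (hS.2 _ hS₀.1) (hS₀.2 _ hS.1)
  have hspan : polySpan D.bracket ≤ 4 * ((n : ℤ) - (k : ℤ)) := by
    refine (polySpan_le_of_support_subset_Icc D.bracket_ne_zero
      (D.support_bracket_subset_Icc fun s => ?_)).trans ?_
    · rw [← hconn s]
      exact D.numPieces_le_stateCircles S s s fun _ _ => rfl
    · have := D.stateCircles_true_add_stateCircles_false_le S hS.1 (hconn _) (hconn _)
      omega
  refine ⟨hspan, fun o => ?_⟩
  have hjones := polySpan_of_support_eq_image _ (D.support_jones o)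
  refine ⟨hjones, ?_⟩
  have : ((polySpan D.bracket : ℤ) : ℚ) ≤ 4 * ((n : ℚ) - (k : ℚ)) := by exact_mod_cast hspan
  linarith
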